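/- A finite sequence $(e_1,\dots,e_m)$ (resp. an infinite sequence $(e_1,e_2,\dots)$) of nonnegative integers is called a finite binomid index of length $m$ (resp. an infinite binomid index) if \[\sum_{i=n-k+1}^{n} e_i\ \ge\ \sum_{i=1}^{k} e_i\] for all integers $1\le k\le n\le m$ (resp. for all integers $1\le k\le n$). Every finite binomid index $\eta$ of length $k$ extends to an infinite binomid index; let $L_k(\eta)=\tilde\eta$ be the lexicographically smallest infinite binomid index that extends $\eta$. Let $\mathbb{I}_k$ be the set of finite binomid indices of length $k$, and let $\langle L_k(\mathbb{I}_k)\rangle$ be the monoid generated by $L_k(\mathbb{I}_k)$ under componentwise addition of sequences. Let $\mathbf{Atom}$ be the set of nonzero infinite binomid indices that are not a sum of two nonzero infinite binomid indices. A subset $A$ of a commutative monoid $M$ is called a basis of $M$ if $A$ generates $M$ and, for every finite sequence $(\beta_i)_{i\le n}$ of pairwise distinct elements of $A$, all nonnegative integers $m_1,\dots,m_n$ and every $1\le j\le n$, the equality $\beta_j=\sum_{i=1}^n m_i\beta_i$ implies $m_j\ge 1$. Then, for every integer $k\ge 1$, the monoid $\langle L_k(\mathbb{I}_k)\rangle$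 is finitely generated. In particular, its basis $\mathbf{Atom}\cap L_k(\mathbb{I}_k)$ is finite; that is, $\mathbf{Atom}\cap L_k(\mathbb{I}_k)$ is a basis of $\langle L_k(\mathbb{I}_k)\rangle$, it is the only one, and it is a finite set. -/

import Mathlib

namespace Binomid

/- A sequence `(e_1, e_2, …)` of nonnegative integers is represented by `η : ℕ → ℕ` with
`η i = e_{i+1}`; a finite sequence `(e_1, …, e_m)` by `ζ : Fin m → ℕ` with `ζ i = e_{i+1}`.
Addition of sequences is componentwise. -/

/-- Infinite binomid indices: for all `1 ≤ k ≤ n`,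
`e_{n-k+1} + ⋯ + e_n ≥ e_1 + ⋯ + e_k`. -/
def IsBinomid (η : ℕ → ℕ) : Prop :=
  ∀ k n : ℕ, 1 ≤ k → k ≤ n →
    ∑ i ∈ Finset.range k, η i ≤ ∑ i ∈ Finset.Ico (n - k) n, η i

/-- The set of finite binomid indices of length `m`: the inequalities of `IsBinomid` are
required for all `1 ≤ k ≤ n ≤ m`. -/
def finiteIndices (m : ℕ) : Set (Fin m → ℕ) :=
  {ζ | ∀ k n : ℕ, 1 ≤ k → k ≤ n → n ≤ m →
    ∑ i : Fin m with i.val < k, ζ i ≤ ∑ i : Fin m with n - k ≤ i.val ∧ i.val < n, ζ i}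

/-- The truncation `(e_1, …, e_m)` of an infinite sequence. -/
def trunc (m : ℕ) (η : ℕ → ℕ) : Fin m → ℕ := fun i => η i

/-- `η` is the lexicographically smallest infinite binomid index that extends `ζ`. -/
def IsLexMinExtension {m : ℕ} (ζ : Fin m → ℕ) (η : ℕ → ℕ) : Prop :=
  IsBinomid η ∧ trunc m η = ζ ∧
    ∀ θ : ℕ → ℕ, IsBinomid θ → trunc m θ = ζ → toLex η ≤ toLex θ

/-- Auxiliary: the partial sums of a binomid extension of `ζ`. -/
def extSum {m : ℕ} (ζ : Fin m → ℕ) (n : ℕ) : ℕ :=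
  if n ≤ m then ∑ i : Fin m with i.val < n, ζ i
  else (Finset.univ : Finset (Fin n)).sup fun i =>
    if _h : 0 < i.val then extSum ζ i.val + extSum ζ (n - i.val) else 0
termination_by n
decreasing_by all_goals omega

theorem extSum_of_le {m : ℕ} (ζ : Fin m → ℕ) {n : ℕ} (h : n ≤ m) :
    extSum ζ n = ∑ i : Fin m with i.val < n, ζ i := by
  rw [extSum, if_pos h]

theorem extSum_zero {m : ℕ} (ζ : Fin m → ℕ) : extSum ζ 0 = 0 := by
  rw [extSum_of_le ζ (Nat.zero_le m)]; simp

theorem extSum_add {m : ℕ} {ζ : Fin m → ℕ} (hζ : ζ ∈ finiteIndices m) (i j : ℕ) :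
    extSum ζ i + extSum ζ j ≤ extSum ζ (i + j) := by
  rcases Nat.eq_zero_or_pos i with rfl | hi
  · simp [extSum_zero]
  rcases Nat.eq_zero_or_pos j with rfl | hj
  · simp [extSum_zero]
  by_cases h : i + j ≤ m
  · have h1 := hζ j (i + j) hj (by omega) h
    rw [extSum_of_le ζ h, extSum_of_le ζ (by omega : i ≤ m), extSum_of_le ζ (by omega : j ≤ m)]
    have h2 : ∑ a : Fin m with a.val < i + j, ζ a =
        ∑ a : Fin m with a.val < i, ζ a +
          ∑ a : Fin m with i + j - j ≤ a.val ∧ a.val < i + j, ζ a := by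
      rw [← Finset.sum_union]
      · congr 1
        ext a
        simp only [Finset.mem_filter, Finset.mem_univ, true_and, Finset.mem_union]
        omega
      · rw [Finset.disjoint_left]
        intro a
        simp only [Finset.mem_filter, Finset.mem_univ, true_and]
        omega
    omega
  · rw [extSum.eq_def ζ (i + j), if_neg h]
    have h3 := Finset.le_sup (f := fun a : Fin (i + j) =>
      if _h : 0 < a.val then extSum ζ a.val + extSum ζ (i + j - a.val) else 0)
      (Finset.mem_univ (⟨i, by omega⟩ : Fin (i + j)))
    simpa [hi] using h3

theorem extSum_le {m : ℕ} (ζ : Fin m → ℕ) {n b : ℕ} (h : m < n)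
    (hb : ∀ i, 0 < i → i < n → extSum ζ i + extSum ζ (n - i) ≤ b) : extSum ζ n ≤ b := by
  rw [extSum, if_neg (by omega)]
  refine Finset.sup_le fun i _ => ?_
  split_ifs with hi
  · exact hb i.val hi i.isLt
  · exact Nat.zero_le b

theorem IsBinomid.add_le {η : ℕ → ℕ} (hη : IsBinomid η) {i j : ℕ} (hj : 0 < j) :
    ∑ a ∈ Finset.range i, η a + ∑ a ∈ Finset.range j, η a ≤
      ∑ a ∈ Finset.range (i + j), η a := by
  have h := hη j (i + j) hj (by omega)
  rw [Nat.add_sub_cancel] at h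
  have := Finset.sum_range_add_sum_Ico η (by omega : i ≤ i + j)
  omega

/-- Every finite binomid index has a lex-minimal extension. -/
theorem exists_isLexMinExtension {m : ℕ} {ζ : Fin m → ℕ} (hζ : ζ ∈ finiteIndices m) :
    ∃ η, IsLexMinExtension ζ η := by
  have hmono : Monotone (extSum ζ) := monotone_nat_of_le_succ fun n =>
    le_trans (Nat.le_add_right _ _) (extSum_add hζ n 1)
  have hsum : ∀ n, ∑ i ∈ Finset.range n, (extSum ζ (i + 1) - extSum ζ i) = extSum ζ n := by
    intro n
    rw [Finset.sum_range_tsub hmono, extSum_zero, Nat.sub_zero]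
  refine ⟨fun n => extSum ζ (n + 1) - extSum ζ n, ?_, ?_, ?_⟩
  · intro k n _ hkn
    have h1 := Finset.sum_range_add_sum_Ico
      (fun n => extSum ζ (n + 1) - extSum ζ n) (by omega : n - k ≤ n)
    beta_reduce at h1 ⊢
    rw [hsum, hsum] at h1
    rw [hsum]
    have h2 := extSum_add hζ (n - k) k
    rw [Nat.sub_add_cancel hkn] at h2
    omega
  · funext a
    change extSum ζ (a.val + 1) - extSum ζ a.val = ζ a
    have ha := a.isLt
    rw [extSum_of_le ζ (by omega : a.val + 1 ≤ m), extSum_of_le ζ (by omega : a.val ≤ m)]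
    have h1 : (Finset.univ.filter fun i : Fin m => i.val < a.val + 1) =
        insert a (Finset.univ.filter fun i : Fin m => i.val < a.val) := by
      ext i
      simp only [Finset.mem_filter, Finset.mem_univ, true_and, Finset.mem_insert, Fin.ext_iff]
      omega
    rw [h1, Finset.sum_insert (by simp)]
    omega
  · intro θ hθ hθt
    by_contra hlt
    rw [not_le] at hlt
    obtain ⟨n, hn1, hn2⟩ := hlt
    change ∀ j, j < n → θ j = extSum ζ (j + 1) - extSum ζ j at hn1
    change θ n < extSum ζ (n + 1) - extSum ζ n at hn2
    have hs : ∀ j, j ≤ n → ∑ i ∈ Finset.range j, θ i = extSum ζ j := by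
      intro j hj
      rw [← hsum j]
      refine Finset.sum_congr rfl fun i hi => hn1 i ?_
      rw [Finset.mem_range] at hi
      omega
    have hle : extSum ζ (n + 1) ≤ ∑ i ∈ Finset.range (n + 1), θ i := by
      by_cases h : n + 1 ≤ m
      · rw [extSum_of_le ζ h, ← hθt]
        refine le_of_eq ?_
        refine Finset.sum_bij (fun a _ => a.val) ?_ ?_ ?_ ?_
        · intro a ha; simpa using ha
        · intro a _ b _ hab; exact Fin.ext hab
        · intro b hb
          rw [Finset.mem_range] at hb
          exact ⟨⟨b, by omega⟩, by simpa using hb, rfl⟩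
        · intro a _; rfl
      · refine extSum_le ζ (by omega) fun i hi hin => ?_
        rw [← hs i (by omega), ← hs (n + 1 - i) (by omega)]
        have h4 := hθ.add_le (i := i) (j := n + 1 - i) (by omega)
        rwa [show i + (n + 1 - i) = n + 1 by omega] at h4
    rw [Finset.sum_range_succ, hs n le_rfl] at hle
    omega

theorem IsLexMinExtension.unique {m : ℕ} {ζ : Fin m → ℕ} {η θ : ℕ → ℕ}
    (hη : IsLexMinExtension ζ η) (hθ : IsLexMinExtension ζ θ) : η = θ :=
  toLex.injective (le_antisymm (hη.2.2 θ hθ.1 hθ.2.1) (hθ.2.2 η hη.1 hη.2.1))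

/-- The map `L_k` that sends a finite binomid index of length `k` to its lex-minimal
extension. -/
noncomputable def lexMin (k : ℕ) (ζ : finiteIndices k) : ℕ → ℕ :=
  Classical.choose (exists_isLexMinExtension ζ.2)

theorem lexMin_spec (k : ℕ) (ζ : finiteIndices k) :
    IsLexMinExtension (ζ : Fin k → ℕ) (lexMin k ζ) :=
  Classical.choose_spec (exists_isLexMinExtension ζ.2)

/-- The set of nonzero atomic (infinite) binomid indices: those that are not the sum of two
nonzero binomid indices. -/
def Atom : Set (ℕ → ℕ) :=
  {η | IsBinomid η ∧ η ≠ 0 ∧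
    ¬ ∃ η₁ η₂ : ℕ → ℕ, IsBinomid η₁ ∧ IsBinomid η₂ ∧ η₁ ≠ 0 ∧ η₂ ≠ 0 ∧ η = η₁ + η₂}

/-- `A` is a basis of the commutative monoid `M`: it spans `M`, and whenever
`β_j = ∑ m_i β_i` for a finite sequence of distinct elements `β_i` of `A` and nonnegative
integers `m_i`, then `m_j ≥ 1`. -/
def IsMonoidBasis {N : Type*} [AddCommMonoid N] (M : AddSubmonoid N) (A : Set N) : Prop :=
  AddSubmonoid.closure A = M ∧
    ∀ (n : ℕ) (β : Fin n → N) (c : Fin n → ℕ), Function.Injective β → (∀ i, β i ∈ A) →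
      ∀ j : Fin n, β j = ∑ i, c i • β i → 1 ≤ c j

/-- The monoid `⟨L_k(𝕀_k)⟩` generated by the lex-minimal extensions of the finite binomid
indices of length `k`. -/
noncomputable def lexMinMonoid (k : ℕ) : AddSubmonoid (ℕ → ℕ) :=
  AddSubmonoid.closure (Set.range (lexMin k))

end Binomid

/-!
A sequence is a binomid index iff its partial sums `f` are superadditive, and it is
lexicographically smallest above its first `k` entries iff every `f n` with `n > k` is attained by
a nontrivial splitting, `f n = f i + f j` with `i + j = n`; hence each `f n` is the sum of `f d`
over some multiset of parts `d ≤ k` of `n`.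

Let `p ≤ k` maximize `f p / p`. Among many parts, the Erdős–Ginzburg–Ziv theorem finds `p` whose
sum is a multiple of `p`, and exchanging these for copies of `p` does not lower the value. So
`f (p + j) = f p + f j` for all `j ≥ 2k²`: the pairs at which `f` is additive can be chosen from a
finite box together with one ray, which leaves finitely many possible patterns. Each pattern cuts
out a face of the cone of superadditive sequences. On such a face the order of the monoid is
detected by `f 1` and finitely many defects `f (i + j) - f i - f j`, so by Dickson's lemma the
face is finitely generated, and so is the sum of all these faces.

If a sum of two binomid indices lies in the image of `L_k`, then so do the summands. Therefore the
atoms in that image are exactly the irreducible elements of the monoid it generates, and these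
form the least generating set.
-/

namespace Binomid

open Finset

section MonoidBasis

variable {N : Type*}

theorem isMonoidBasis_iff_notMem_closure_diff [AddCommMonoid N] {M : AddSubmonoid N} {A : Set N} :
    IsMonoidBasis M A ↔
      AddSubmonoid.closure A = M ∧ ∀ a ∈ A, a ∉ AddSubmonoid.closure (A \ {a}) := by
  refine and_congr_right fun _ => ⟨fun h a ha hmem => ?_, fun h n β c hβ hβA j hj => ?_⟩
  · obtain ⟨c, t, htA, -, hsum⟩ := AddSubmonoid.mem_closure_iff_exists_finset_subset.1 hmem
    let e : Fin #t ≃ t := t.equivFin.symm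
    have ha_notMem : a ∉ Set.range fun i => (e i : N) := fun ⟨i, hi⟩ => (htA (e i).2).2 hi
    have hinj : Function.Injective (Fin.cons a fun i => (e i : N) : Fin (#t + 1) → N) :=
      Fin.cons_injective_of_injective ha_notMem (Subtype.val_injective.comp e.injective)
    have hone := h (#t + 1) (Fin.cons a fun i => (e i : N)) (Fin.cons 0 fun i => c (e i)) hinj
      (Fin.cases ha fun i => (htA (e i).2).1) 0 <| by
        simp only [Fin.sum_univ_succ, Fin.cons_zero, Fin.cons_succ, zero_smul, zero_add]
        rw [e.sum_comp fun b : t => c b • (b : N), sum_coe_sort t fun b => c b • b, hsum]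
    simp at hone
  · by_contra! hcj
    refine h (β j) (hβA j) ?_
    suffices ∑ i, c i • β i ∈ AddSubmonoid.closure (A \ {β j}) from hj ▸ this
    refine sum_mem fun i _ => ?_
    rcases eq_or_ne i j with rfl | hij
    · simp [Nat.lt_one_iff.1 hcj]
    · have hmem : β i ∈ A \ {β j} := ⟨hβA i, hβ.ne hij⟩
      exact nsmul_mem (AddSubmonoid.subset_closure hmem) _

theorem isMonoidBasis_iff_minimal [AddCommMonoid N] {M : AddSubmonoid N} {A : Set N} :
    IsMonoidBasis M A ↔ Minimal (· ∈ {S | AddSubmonoid.closure S = M}) A := by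
  rw [isMonoidBasis_iff_notMem_closure_diff]
  refine and_congr_right fun hA => ⟨fun h B hB hBA a ha => ?_, fun h a ha hmem => ?_⟩
  · by_contra haB
    refine h a ha (AddSubmonoid.closure_mono (Set.subset_sdiff_singleton hBA haB) ?_)
    rw [hB.out, ← hA]
    exact AddSubmonoid.subset_closure ha
  · have hgen : AddSubmonoid.closure (A \ {a}) = M :=
      (AddSubmonoid.closure_sdiff_eq_closure (Set.singleton_subset_iff.2 hmem)).trans hA
    exact (h hgen Set.sdiff_subset ha).2 rfl

instance subsingleton_addUnits_coe [AddMonoid N] [Subsingleton (AddUnits N)]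
    (M : AddSubmonoid N) : Subsingleton (AddUnits M) :=
  (AddUnits.map_injective (f := M.subtype) Subtype.val_injective).subsingleton

theorem isLeast_image_addIrreducible [AddCommMonoid N] [IsCancelAdd N]
    [Subsingleton (AddUnits N)] {M : AddSubmonoid N} (hM : M.FG) :
    IsLeast {S | AddSubmonoid.closure S = M} (Subtype.val '' {x : M | AddIrreducible x}) := by
  constructor
  · have : AddMonoid.FG M := (AddMonoid.fg_iff_addSubmonoid_fg M).2 hM
    let _ : AddCancelCommMonoid M :=
      { (inferInstance : AddCommMonoid M), (inferInstance : IsCancelAdd M) with }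
    have hgen : AddSubmonoid.closure {x : M | AddIrreducible x} = ⊤ :=
      AddSubmonoid.closure_addIrreducible
    change AddSubmonoid.closure (M.subtype '' _) = M
    rw [← AddMonoidHom.map_mclosure, hgen, ← AddMonoidHom.mrange_eq_map,
      AddSubmonoid.mrange_subtype]
  · rintro S rfl
    exact Set.image_subset_iff.2 <| addIrreducible_subset_of_addSubmonoidClosure_eq_top
      AddSubmonoid.closure_closure_coe_preimage

theorem fg_of_le_imp_exists_add {C W : Type*} [AddCommMonoid C] [IsCancelAdd C]
    [Subsingleton (AddUnits C)] [AddCommMonoid W] [PartialOrder W] [WellQuasiOrderedLE W]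
    [IsOrderedCancelAddMonoid W] [CanonicallyOrderedAdd W] (φ : C →+ W)
    (hφ : ∀ x y, φ x ≤ φ y → ∃ z, y = x + z) :
    AddMonoid.FG C := by
  have hinj : Function.Injective φ := by
    intro x y hxy
    obtain ⟨z, rfl⟩ := hφ x y hxy.le
    obtain ⟨w, hw⟩ := hφ _ x hxy.ge
    rw [add_assoc, left_eq_add] at hw
    rw [(add_eq_zero.1 hw).1, add_zero]
  have hsub : ∀ v ∈ AddMonoidHom.mrange φ, ∀ w, v + w ∈ AddMonoidHom.mrange φ →
      w ∈ AddMonoidHom.mrange φ := by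
    rintro _ ⟨x, rfl⟩ w ⟨y, hy⟩
    obtain ⟨z, rfl⟩ := hφ x y (hy ▸ le_self_add)
    exact ⟨z, add_left_cancel ((map_add φ x z).symm.trans hy)⟩
  have hrange := AddSubmonoid.fg_of_subtractive hsub
  rw [AddMonoidHom.mrange_eq_map] at hrange
  exact ⟨hrange.map_injective φ hinj⟩

end MonoidBasis

section Superadditive

/-- Superadditive sequences of natural numbers. By `isBinomid_iff_isSuperadditive` they are the
partial sums of binomid indices, and all of the combinatorics takes place on them. -/
def IsSuperadditive (f : ℕ → ℕ) : Prop :=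
  ∀ i j, f i + f j ≤ f (i + j)

/-- Above `k`, every value of `f` is attained by a nontrivial splitting of its argument. For
superadditive `f` this says that `f` is the least superadditive continuation of its values on
`0, …, k`. -/
def SplitsAbove (k : ℕ) (f : ℕ → ℕ) : Prop :=
  ∀ n, k < n → ∃ i j, 0 < i ∧ 0 < j ∧ i + j = n ∧ f n = f i + f j

variable {f g : ℕ → ℕ} {k : ℕ}

theorem IsSuperadditive.map_zero (hf : IsSuperadditive f) : f 0 = 0 := by
  simpa using hf 0 0

theorem IsSuperadditive.monotone (hf : IsSuperadditive f) : Monotone f :=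
  monotone_nat_of_le_succ fun n => le_of_add_le_left (hf n 1)

theorem IsSuperadditive.add (hf : IsSuperadditive f) (hg : IsSuperadditive g) :
    IsSuperadditive (f + g) := fun i j =>
  (add_add_add_comm ..).trans_le (add_le_add (hf i j) (hg i j))

theorem IsSuperadditive.sum_map_le (hf : IsSuperadditive f) (s : Multiset ℕ) :
    (s.map f).sum ≤ f s.sum :=
  Multiset.le_sum_of_subadditive (β := ℕᵒᵈ) f hf.map_zero.ge hf s

theorem IsSuperadditive.update_sub_one (hf : IsSuperadditive f) {n : ℕ}
    (hn : ∀ i j, 0 < i → 0 < j → i + j = n → f i + f j < f n) :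
    IsSuperadditive (Function.update f n (f n - 1)) := by
  intro i j
  have hle : ∀ m, Function.update f n (f n - 1) m ≤ f m :=
    update_le_self_iff.2 (Nat.sub_le _ _)
  have h0 : Function.update f n (f n - 1) 0 = 0 :=
    Nat.le_zero.1 ((hle 0).trans_eq hf.map_zero)
  rcases Nat.eq_zero_or_pos i with rfl | hi
  · simp [h0]
  rcases Nat.eq_zero_or_pos j with rfl | hj
  · simp [h0]
  have hij := add_le_add (hle i) (hle j)
  by_cases hn' : i + j = n
  · have := hn i j hi hj hn'
    rw [hn', Function.update_self]
    omega
  · rw [Function.update_of_ne hn']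
    exact hij.trans (hf i j)

theorem SplitsAbove.of_add (h : SplitsAbove k (f + g)) (hf : IsSuperadditive f)
    (hg : IsSuperadditive g) : SplitsAbove k f := by
  intro n hn
  obtain ⟨i, j, hi, hj, rfl, hsplit⟩ := h n hn
  refine ⟨i, j, hi, hj, rfl, ?_⟩
  have := hf i j
  have := hg i j
  simp only [Pi.add_apply] at hsplit
  omega

theorem SplitsAbove.exists_multiset (h : SplitsAbove k f) {n : ℕ} (hn : 0 < n) :
    ∃ s : Multiset ℕ, (∀ d ∈ s, 0 < d ∧ d ≤ k) ∧ s.sum = n ∧ (s.map f).sum = f n := by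
  induction n using Nat.strong_induction_on with
  | _ n ih =>
    by_cases hnk : n ≤ k
    · exact ⟨{n}, by simp [hn, hnk]⟩
    obtain ⟨i, j, hi, hj, rfl, hsplit⟩ := h n (by omega)
    obtain ⟨s, hs, hsum, hval⟩ := ih i (by omega) hi
    obtain ⟨t, ht, htsum, htval⟩ := ih j (by omega) hj
    refine ⟨s + t, fun d hd => ?_, by simp [hsum, htsum], by simp [hval, htval, hsplit]⟩
    exact (Multiset.mem_add.1 hd).elim (hs d) (ht d)

theorem exists_max_average (f : ℕ → ℕ) (hk : 1 ≤ k) :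
    ∃ p ∈ Set.Icc 1 k, ∀ d ∈ Set.Icc 1 k, p * f d ≤ d * f p := by
  obtain ⟨p, hp, hmax⟩ := exists_max_image (Icc 1 k) (fun d => (f d : ℚ) / d) ⟨1, by simp [hk]⟩
  rw [mem_Icc] at hp
  refine ⟨p, hp, fun d hd => ?_⟩
  have hdp := hmax d (mem_Icc.2 hd)
  rw [div_le_div_iff₀ (by exact_mod_cast hd.1) (by exact_mod_cast hp.1)] at hdp
  rw [mul_comm p, mul_comm d]
  exact_mod_cast hdp

theorem exists_le_card_eq_dvd_sum (s : Multiset ℕ) {p : ℕ} (hs : 2 * p - 1 ≤ s.card) :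
    ∃ t ≤ s, t.card = p ∧ p ∣ t.sum := by
  obtain ⟨t, hts, hcard, hdvd⟩ := Int.erdos_ginzburg_ziv (s := s.toEnumFinset)
    (fun x => (x.1 : ℤ)) (by simpa using hs)
  refine ⟨t.1.map Prod.fst, Multiset.map_fst_le_of_subset_toEnumFinset hts, by simpa using hcard,
    ?_⟩
  rw [← Nat.cast_sum] at hdvd
  exact Int.natCast_dvd_natCast.1 hdvd

theorem sum_map_le_of_max_average {p q : ℕ} (hp : 0 < p) {t : Multiset ℕ}
    (hmax : ∀ d ∈ t, p * f d ≤ d * f p) (ht : t.sum = p * q) : (t.map f).sum ≤ q * f p := by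
  refine Nat.le_of_mul_le_mul_left ?_ hp
  calc p * (t.map f).sum = (t.map fun d => p * f d).sum := Multiset.sum_map_mul_left.symm
    _ ≤ (t.map fun d => d * f p).sum := Multiset.sum_map_le_sum_map _ _ hmax
    _ = p * (q * f p) := by rw [Multiset.sum_map_mul_right, Multiset.map_id', ht, mul_assoc]

theorem IsSuperadditive.exists_period (hf : IsSuperadditive f) (hk : 1 ≤ k)
    (h : SplitsAbove k f) :
    ∃ p ∈ Set.Icc 1 k, ∀ j, 2 * k * k ≤ j → f (p + j) = f p + f j := by
  obtain ⟨p, ⟨hp, hpk⟩, hmax⟩ := exists_max_average f hk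
  refine ⟨p, ⟨hp, hpk⟩, fun j hj => (hf p j).antisymm' ?_⟩
  obtain ⟨s, hs, hsum, hval⟩ := h.exists_multiset (n := p + j) (by omega)
  have hcard : 2 * k ≤ s.card := by
    have hle : s.sum ≤ s.card * k := Multiset.sum_le_card_nsmul s k fun d hd => (hs d hd).2
    exact Nat.le_of_mul_le_mul_right (by omega) hk
  obtain ⟨t, hts, htcard, q, hq⟩ := exists_le_card_eq_dvd_sum s (p := p) (by omega)
  obtain ⟨u, rfl⟩ := exists_add_of_le hts
  have hmem : ∀ d ∈ t, d ∈ Set.Icc 1 k := fun d hd => hs d (Multiset.mem_of_le hts hd)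
  have htf : (t.map f).sum ≤ q * f p :=
    sum_map_le_of_max_average hp (fun d hd => hmax d (hmem d hd)) hq
  obtain ⟨q, rfl⟩ : ∃ q', q = q' + 1 := Nat.exists_eq_add_one.2 <| by
    have hle : t.card • 1 ≤ t.sum := Multiset.card_nsmul_le_sum fun d hd => (hmem d hd).1
    rw [htcard, hq, smul_eq_mul] at hle
    exact Nat.le_of_mul_le_mul_left hle hp
  have hj : j = p * q + u.sum := by
    rw [Multiset.sum_add, hq, mul_add_one] at hsum
    omega
  calc f (p + j) = (t.map f).sum + (u.map f).sum := by
          rw [← hval, Multiset.map_add, Multiset.sum_add]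
    _ ≤ (q + 1) * f p + (u.map f).sum := by gcongr
    _ = f p + ((Multiset.replicate q p + u).map f).sum := by
          rw [Multiset.map_add, Multiset.map_replicate, Multiset.sum_add, Multiset.sum_replicate,
            smul_eq_mul]
          ring
    _ ≤ f p + f j := by
      gcongr
      rw [hj]
      simpa [mul_comm] using hf.sum_map_le (Multiset.replicate q p + u)

end Superadditive

section Face

/-- The face of the cone of superadditive sequences cut out by the equalities
`f (i + j) = f i + f j` for `(i, j) ∈ E`. -/
def superadditiveFace (E : Set (ℕ × ℕ)) : AddSubmonoid (ℕ → ℕ) where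
  carrier := {f | IsSuperadditive f ∧ ∀ e ∈ E, f (e.1 + e.2) = f e.1 + f e.2}
  zero_mem' := ⟨fun _ _ => le_rfl, fun _ _ => rfl⟩
  add_mem' := fun ⟨hf, hfE⟩ ⟨hg, hgE⟩ => ⟨hf.add hg, fun e he => by
    simp only [Pi.add_apply, hfE e he, hgE e he, add_add_add_comm]⟩

/-- The defect of superadditivity of `f` at `(i, j)`; the truncated subtraction is exact for
superadditive `f`. -/
def defect (f : ℕ → ℕ) (i j : ℕ) : ℕ :=
  f (i + j) - (f i + f j)

variable {f g : ℕ → ℕ} {E : Set (ℕ × ℕ)}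

theorem IsSuperadditive.add_defect (hf : IsSuperadditive f) (i j : ℕ) :
    f i + f j + defect f i j = f (i + j) :=
  Nat.add_sub_cancel' (hf i j)

theorem defect_comm (f : ℕ → ℕ) (i j : ℕ) : defect f i j = defect f j i := by
  rw [defect, defect, add_comm i, add_comm (f i)]

theorem defect_add (hf : IsSuperadditive f) (hg : IsSuperadditive g) (i j : ℕ) :
    defect (f + g) i j = defect f i j + defect g i j := by
  have := hf.add_defect i j
  have := hg.add_defect i j
  simp only [defect, Pi.add_apply] at *
  omega

theorem defect_add_left_of_period {p i : ℕ} (hi : f (p + i) = f p + f i) {j : ℕ}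
    (hij : f (p + (i + j)) = f p + f (i + j)) : defect f (p + i) j = defect f i j := by
  simp only [defect, add_assoc, hi, hij]
  omega

theorem defect_le_of_period {p M : ℕ} (hp : 0 < p) (hf : ∀ j, M ≤ j → f (p + j) = f p + f j)
    (hg : ∀ j, M ≤ j → g (p + j) = g p + g j)
    (hle : ∀ i < M + p, ∀ j < M + p, defect f i j ≤ defect g i j) (i j : ℕ) :
    defect f i j ≤ defect g i j := by
  induction hn : i + j using Nat.strong_induction_on generalizing i j with
  | _ n ih =>
    wlog hji : j ≤ i generalizing i j
    · rw [defect_comm f, defect_comm g]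
      exact this j i (by omega) (by omega)
    by_cases hi : i < M + p
    · exact hle i hi j (by omega)
    · obtain ⟨i, rfl⟩ := exists_add_of_le (show p ≤ i by omega)
      rw [defect_add_left_of_period (hf i (by omega)) (hf (i + j) (by omega)),
        defect_add_left_of_period (hg i (by omega)) (hg (i + j) (by omega))]
      exact ih (i + j) (by omega) i j rfl

theorem exists_eq_add_of_defect_le (hf : f ∈ superadditiveFace E) (hg : g ∈ superadditiveFace E)
    (hone : f 1 ≤ g 1) (hdefect : ∀ i j, defect f i j ≤ defect g i j) :
    ∃ h ∈ superadditiveFace E, g = f + h := by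
  have hle : f ≤ g := by
    intro n
    induction n with
    | zero => rw [hf.1.map_zero, hg.1.map_zero]
    | succ n ih =>
      rw [← hf.1.add_defect, ← hg.1.add_defect]
      gcongr
      exact hdefect n 1
  obtain ⟨h, rfl⟩ := exists_add_of_le hle
  refine ⟨h, ⟨fun i j => ?_, fun e he => ?_⟩, rfl⟩
  · have hd := hdefect i j
    have := hf.1.add_defect i j
    have := hg.1.add_defect i j
    simp only [Pi.add_apply] at this
    omega
  · have := hf.2 e he
    have := hg.2 e he
    simp only [Pi.add_apply] at this
    omega

theorem superadditiveFace_fg {p M : ℕ} (hp : 0 < p) (hE : ∀ j, M ≤ j → (p, j) ∈ E) :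
    (superadditiveFace E).FG := by
  let φ : superadditiveFace E →+ ℕ × (Fin (M + p) → Fin (M + p) → ℕ) :=
    { toFun := fun f => (f.1 1, fun i j => defect f i j)
      map_zero' := rfl
      map_add' := fun f g => Prod.ext rfl <| funext₂ fun i j => defect_add f.2.1 g.2.1 i j }
  refine (AddMonoid.fg_iff_addSubmonoid_fg _).1 (fg_of_le_imp_exists_add φ ?_)
  rintro ⟨f, hf⟩ ⟨g, hg⟩ ⟨hone, hle⟩
  have hdefect := defect_le_of_period hp (fun j hj => hf.2 _ (hE j hj))
    (fun j hj => hg.2 _ (hE j hj)) fun i hi j hj => hle ⟨i, hi⟩ ⟨j, hj⟩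
  obtain ⟨h, hh, hgh⟩ := exists_eq_add_of_defect_le hf hg hone hdefect
  exact ⟨⟨h, hh⟩, Subtype.ext hgh⟩

/-- The sets `E` of pairs that contain a nontrivial splitting of every `n > k` and consist of
finitely many pairs, of bounded size, together with the pairs `(p, j)`, `j ≥ 2k²`, for
some `1 ≤ p ≤ k`. -/
def splittingPatterns (k : ℕ) : Set (Set (ℕ × ℕ)) :=
  {E | (∀ n, k < n → ∃ i j, 0 < i ∧ 0 < j ∧ i + j = n ∧ (i, j) ∈ E) ∧
    ∃ p ∈ Set.Icc 1 k, ∃ T ⊆ Set.Iio (2 * k * k + k) ×ˢ Set.Iio (2 * k * k + k),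
      E = T ∪ {p} ×ˢ Set.Ici (2 * k * k)}

theorem splittingPatterns_finite (k : ℕ) : (splittingPatterns k).Finite := by
  have hbox : (Set.Iio (2 * k * k + k) ×ˢ Set.Iio (2 * k * k + k)).Finite :=
    (Set.finite_Iio _).prod (Set.finite_Iio _)
  refine ((Set.finite_Icc 1 k).image2 (fun p T => T ∪ {p} ×ˢ Set.Ici (2 * k * k))
    hbox.finite_subsets).subset ?_
  rintro _ ⟨-, p, hp, T, hT, rfl⟩
  exact ⟨p, hp, T, hT, rfl⟩

theorem setOf_isSuperadditive_and_splitsAbove {k : ℕ} (hk : 1 ≤ k) :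
    {f | IsSuperadditive f ∧ SplitsAbove k f} =
      ⋃ E ∈ splittingPatterns k, (superadditiveFace E : Set (ℕ → ℕ)) := by
  ext f
  simp only [Set.mem_iUnion₂, Set.mem_ofPred_eq, SetLike.mem_coe, exists_prop]
  constructor
  · rintro ⟨hf, hsplit⟩
    obtain ⟨p, hp, hper⟩ := hf.exists_period hk hsplit
    set L := 2 * k * k
    let T : Set (ℕ × ℕ) := {e | (e.1 < L + k ∧ e.2 < L + k) ∧ f (e.1 + e.2) = f e.1 + f e.2}
    refine ⟨T ∪ {p} ×ˢ Set.Ici L, ⟨fun n hn => ?_, p, hp, T, fun e he => he.1, rfl⟩, hf, ?_⟩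
    · obtain ⟨hp1, hpk⟩ := hp
      by_cases hnL : n < L + k
      · obtain ⟨i, j, hi, hj, rfl, hij⟩ := hsplit n hn
        exact ⟨i, j, hi, hj, rfl, .inl ⟨⟨by omega, by omega⟩, hij⟩⟩
      · exact ⟨p, n - p, hp1, by omega, by omega, .inr ⟨rfl, Set.mem_Ici.2 (by omega)⟩⟩
    · rintro ⟨i, j⟩ (⟨-, hij⟩ | ⟨rfl, hj⟩)
      exacts [hij, hper j hj]
  · rintro ⟨E, ⟨hE, -⟩, hf, hfE⟩
    refine ⟨hf, fun n hn => ?_⟩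
    obtain ⟨i, j, hi, hj, rfl, hij⟩ := hE n hn
    exact ⟨i, j, hi, hj, rfl, hfE _ hij⟩

theorem fg_closure_isSuperadditive_and_splitsAbove {k : ℕ} (hk : 1 ≤ k) :
    (AddSubmonoid.closure {f | IsSuperadditive f ∧ SplitsAbove k f}).FG := by
  simp only [setOf_isSuperadditive_and_splitsAbove hk, AddSubmonoid.closure_iUnion,
    AddSubmonoid.closure_eq]
  refine AddSubmonoid.FG.biSup (splittingPatterns_finite k) _ ?_
  rintro _ ⟨-, p, ⟨hp, -⟩, T, -, rfl⟩
  exact superadditiveFace_fg hp fun j hj => .inr ⟨rfl, hj⟩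

end Face

section PartialSums

/-- The sequence of partial sums `n ↦ e_1 + ⋯ + e_n`, as an additive map. -/
def partialSums : (ℕ → ℕ) →+ (ℕ → ℕ) where
  toFun η n := ∑ i ∈ range n, η i
  map_zero' := by ext; simp
  map_add' η θ := by ext; simp [sum_add_distrib]

variable {η θ : ℕ → ℕ} {k : ℕ}

theorem partialSums_apply (η : ℕ → ℕ) (n : ℕ) : partialSums η n = ∑ i ∈ range n, η i := rfl

theorem partialSums_succ (η : ℕ → ℕ) (n : ℕ) :
    partialSums η (n + 1) = partialSums η n + η n :=
  sum_range_succ η n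

theorem forall_lt_eq_iff_partialSums {m : ℕ} :
    (∀ i < m, η i = θ i) ↔ ∀ n ≤ m, partialSums η n = partialSums θ n := by
  refine ⟨fun h n hn => sum_congr rfl fun i hi => h i ((mem_range.1 hi).trans_le hn),
    fun h i hi => ?_⟩
  have := h (i + 1) hi
  rwa [partialSums_succ, partialSums_succ, h i hi.le, Nat.add_left_cancel_iff] at this

theorem partialSums_injective : Function.Injective partialSums := fun _ _ h =>
  funext fun n => forall_lt_eq_iff_partialSums.2 (fun m _ => congrFun h m) n n.lt_succ_self

theorem trunc_eq_trunc_iff :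
    trunc k η = trunc k θ ↔ ∀ n ≤ k, partialSums η n = partialSums θ n := by
  rw [← forall_lt_eq_iff_partialSums, funext_iff, Fin.forall_iff]
  rfl

theorem toLex_partialSums_lt_iff :
    toLex (partialSums η) < toLex (partialSums θ) ↔ toLex η < toLex θ := by
  constructor
  · rintro ⟨n, heq, hlt⟩
    change ∀ j < n, partialSums η j = partialSums θ j at heq
    change partialSums η n < partialSums θ n at hlt
    obtain ⟨n, rfl⟩ : ∃ m, n = m + 1 := Nat.exists_eq_add_one.2 <|
      Nat.pos_of_ne_zero fun h => by simp [h, partialSums_apply] at hlt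
    rw [partialSums_succ, partialSums_succ, heq n n.lt_succ_self] at hlt
    exact ⟨n, forall_lt_eq_iff_partialSums.2 fun j hj => heq j (Nat.lt_succ_of_le hj),
      Nat.lt_of_add_lt_add_left hlt⟩
  · rintro ⟨n, heq, hlt⟩
    change ∀ j < n, η j = θ j at heq
    change η n < θ n at hlt
    have hsum := forall_lt_eq_iff_partialSums.1 heq
    refine ⟨n + 1, fun j hj => hsum j (Nat.le_of_lt_succ hj), ?_⟩
    change partialSums η (n + 1) < partialSums θ (n + 1)
    rw [partialSums_succ, partialSums_succ, ← hsum n le_rfl]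
    exact Nat.add_lt_add_left hlt _

theorem isBinomid_iff_isSuperadditive : IsBinomid η ↔ IsSuperadditive (partialSums η) := by
  refine ⟨fun h i j => ?_, fun h k n _ hkn => ?_⟩
  · rcases Nat.eq_zero_or_pos j with rfl | hj
    · simp [partialSums_apply]
    · exact h.add_le hj
  · have hsplit := sum_range_add_sum_Ico η (Nat.sub_le n k)
    have hadd := h (n - k) k
    rw [Nat.sub_add_cancel hkn] at hadd
    simp only [partialSums_apply] at hadd
    omega

theorem IsSuperadditive.exists_isBinomid {f : ℕ → ℕ} (hf : IsSuperadditive f) :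
    ∃ η, IsBinomid η ∧ partialSums η = f := by
  have hsum : partialSums (fun n => f (n + 1) - f n) = f := by
    ext n
    rw [partialSums_apply, sum_range_tsub hf.monotone, hf.map_zero, Nat.sub_zero]
  exact ⟨_, isBinomid_iff_isSuperadditive.2 (hsum.symm ▸ hf), hsum⟩

theorem sum_filter_trunc {m : ℕ} (η : ℕ → ℕ) (P : ℕ → Prop) [DecidablePred P]
    (hP : ∀ i, P i → i < m) {s : Finset ℕ} (hs : ∀ i, i ∈ s ↔ P i) :
    ∑ i : Fin m with P i.val, trunc m η i = ∑ i ∈ s, η i := by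
  have hfilter : (range m).filter P = s := by
    ext i
    simpa [hs] using hP i
  rw [← hfilter, sum_filter, sum_filter]
  exact Fin.sum_univ_eq_sum_range (fun i => if P i then η i else 0) m

theorem IsBinomid.trunc_mem_finiteIndices (hη : IsBinomid η) (m : ℕ) :
    trunc m η ∈ finiteIndices m := by
  intro k n hk hkn hnm
  rw [sum_filter_trunc η (· < k) (by omega) fun _ => mem_range,
    sum_filter_trunc η (fun i => n - k ≤ i ∧ i < n) (by omega) fun _ => mem_Ico]
  exact hη k n hk hkn

end PartialSums

section LexMin

variable {η θ : ℕ → ℕ} {k : ℕ}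

theorem IsLexMinExtension.splitsAbove (hk : 1 ≤ k) {ζ : Fin k → ℕ} (h : IsLexMinExtension ζ η) :
    SplitsAbove k (partialSums η) := by
  obtain ⟨hη, hζ, hmin⟩ := h
  have hsup := isBinomid_iff_isSuperadditive.1 hη
  intro n hn
  by_contra! hne
  have hlt : ∀ i j, 0 < i → 0 < j → i + j = n →
      partialSums η i + partialSums η j < partialSums η n := fun i j hi hj hij =>
    lt_of_le_of_ne (hij ▸ hsup i j) (hne i j hi hj hij).symm
  obtain ⟨θ, hθ, hθη⟩ := (hsup.update_sub_one hlt).exists_isBinomid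
  have htrunc : trunc k θ = trunc k η := trunc_eq_trunc_iff.2 fun m hm => by
    rw [hθη, Function.update_of_ne (by omega)]
  refine (hmin θ hθ (htrunc.trans hζ)).not_gt (toLex_partialSums_lt_iff.1 ?_)
  rw [hθη, Pi.toLex_update_lt_self_iff]
  have := hlt 1 (n - 1) one_pos (by omega) (by omega)
  omega

theorem IsBinomid.isLexMinExtension_trunc (hη : IsBinomid η)
    (hsplit : SplitsAbove k (partialSums η)) : IsLexMinExtension (trunc k η) η := by
  refine ⟨hη, rfl, fun θ hθ hθη => ?_⟩
  by_contra! hlt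
  obtain ⟨n, heq, hlt⟩ := toLex_partialSums_lt_iff.2 hlt
  change ∀ j < n, partialSums θ j = partialSums η j at heq
  change partialSums θ n < partialSums η n at hlt
  have hkn : k < n := by
    by_contra! hnk
    exact hlt.ne (trunc_eq_trunc_iff.1 hθη n hnk)
  obtain ⟨i, j, hi, hj, rfl, hij⟩ := hsplit n hkn
  rw [hij, ← heq i (by omega), ← heq j (by omega)] at hlt
  exact hlt.not_ge (isBinomid_iff_isSuperadditive.1 hθ i j)

theorem mem_range_lexMin_iff (hk : 1 ≤ k) :
    η ∈ Set.range (lexMin k) ↔ IsBinomid η ∧ SplitsAbove k (partialSums η) := by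
  constructor
  · rintro ⟨ζ, rfl⟩
    exact ⟨(lexMin_spec k ζ).1, (lexMin_spec k ζ).splitsAbove hk⟩
  · rintro ⟨hη, hsplit⟩
    exact ⟨⟨_, hη.trunc_mem_finiteIndices k⟩,
      (lexMin_spec k _).unique (hη.isLexMinExtension_trunc hsplit)⟩

theorem image_partialSums_range_lexMin (hk : 1 ≤ k) :
    partialSums '' Set.range (lexMin k) = {f | IsSuperadditive f ∧ SplitsAbove k f} := by
  ext f
  constructor
  · rintro ⟨η, hη, rfl⟩
    obtain ⟨hη, hsplit⟩ := (mem_range_lexMin_iff hk).1 hη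
    exact ⟨isBinomid_iff_isSuperadditive.1 hη, hsplit⟩
  · rintro ⟨hf, hsplit⟩
    obtain ⟨η, hη, rfl⟩ := hf.exists_isBinomid
    exact ⟨η, (mem_range_lexMin_iff hk).2 ⟨hη, hsplit⟩, rfl⟩

theorem lexMinMonoid_fg (hk : 1 ≤ k) : (lexMinMonoid k).FG := by
  refine AddSubmonoid.FG.map_injective partialSums partialSums_injective ?_
  rw [lexMinMonoid, AddMonoidHom.map_mclosure, image_partialSums_range_lexMin hk]
  exact fg_closure_isSuperadditive_and_splitsAbove hk

theorem isBinomid_of_mem_lexMinMonoid (h : η ∈ lexMinMonoid k) : IsBinomid η := by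
  induction h using AddSubmonoid.closure_induction with
  | mem _ hη =>
    obtain ⟨ζ, rfl⟩ := hη
    exact (lexMin_spec k ζ).1
  | zero => exact fun _ _ _ _ => by simp
  | add η θ _ _ hη hθ =>
    rw [isBinomid_iff_isSuperadditive] at *
    exact map_add partialSums η θ ▸ hη.add hθ

theorem IsBinomid.mem_range_lexMin_of_add (hk : 1 ≤ k) (hη : IsBinomid η) (hθ : IsBinomid θ)
    (h : η + θ ∈ Set.range (lexMin k)) : η ∈ Set.range (lexMin k) := by
  rw [mem_range_lexMin_iff hk, map_add] at h
  rw [isBinomid_iff_isSuperadditive] at hη hθ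
  exact (mem_range_lexMin_iff hk).2 ⟨isBinomid_iff_isSuperadditive.2 hη, h.2.of_add hη hθ⟩

theorem image_addIrreducible_lexMinMonoid (hk : 1 ≤ k) :
    Subtype.val '' {x : lexMinMonoid k | AddIrreducible x} = Atom ∩ Set.range (lexMin k) := by
  ext η
  constructor
  · rintro ⟨x, hx, rfl⟩
    have hrange : x.1 ∈ Set.range (lexMin k) :=
      (isLeast_image_addIrreducible (lexMinMonoid_fg hk)).2 rfl ⟨x, hx, rfl⟩
    refine ⟨⟨isBinomid_of_mem_lexMinMonoid x.2, fun h0 => hx.out.ne_zero (Subtype.ext h0), ?_⟩,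
      hrange⟩
    rintro ⟨η, θ, hη, hθ, hη0, hθ0, hsum⟩
    rw [hsum] at hrange
    let y : lexMinMonoid k :=
      ⟨η, AddSubmonoid.subset_closure (hη.mem_range_lexMin_of_add hk hθ hrange)⟩
    let z : lexMinMonoid k :=
      ⟨θ, AddSubmonoid.subset_closure (hθ.mem_range_lexMin_of_add hk hη (add_comm η θ ▸ hrange))⟩
    rcases hx.out.isAddUnit_or_isAddUnit (show x = y + z from Subtype.ext hsum) with h | h
    exacts [hη0 (congrArg Subtype.val (isAddUnit_iff_eq_zero.1 h)),
      hθ0 (congrArg Subtype.val (isAddUnit_iff_eq_zero.1 h))]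
  · rintro ⟨⟨-, hη0, hatom⟩, hrange⟩
    refine ⟨⟨η, AddSubmonoid.subset_closure hrange⟩, ⟨?_, fun y z hyz => ?_⟩, rfl⟩
    · exact fun h => hη0 (congrArg Subtype.val (isAddUnit_iff_eq_zero.1 h))
    · by_contra! h
      simp only [isAddUnit_iff_eq_zero] at h
      exact hatom ⟨y, z, isBinomid_of_mem_lexMinMonoid y.2, isBinomid_of_mem_lexMinMonoid z.2,
        fun h0 => h.1 (Subtype.ext h0), fun h0 => h.2 (Subtype.ext h0), congrArg Subtype.val hyz⟩

theorem isLeast_atom_inter_range_lexMin (hk : 1 ≤ k) :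
    IsLeast {S | AddSubmonoid.closure S = lexMinMonoid k} (Atom ∩ Set.range (lexMin k)) :=
  image_addIrreducible_lexMinMonoid hk ▸ isLeast_image_addIrreducible (lexMinMonoid_fg hk)

end LexMin

end Binomid

theorem mainTheorem6 (k : ℕ) (hk : 1 ≤ k) :
    (Binomid.lexMinMonoid k).FG ∧
    Binomid.IsMonoidBasis (Binomid.lexMinMonoid k)
      (Binomid.Atom ∩ Set.range (Binomid.lexMin k)) ∧
    (∀ B : Set (ℕ → ℕ), Binomid.IsMonoidBasis (Binomid.lexMinMonoid k) B →
      B = Binomid.Atom ∩ Set.range (Binomid.lexMin k)) ∧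
    (Binomid.Atom ∩ Set.range (Binomid.lexMin k)).Finite := by
  have hfg := Binomid.lexMinMonoid_fg hk
  have hleast := Binomid.isLeast_atom_inter_range_lexMin hk
  have hfinite : (Binomid.Atom ∩ Set.range (Binomid.lexMin k)).Finite := by
    obtain ⟨F, hF⟩ := hfg
    exact F.finite_toSet.subset (hleast.2 hF)
  refine ⟨hfg, Binomid.isMonoidBasis_iff_minimal.2 hleast.minimal, fun B hB => ?_, hfinite⟩
  exact (Binomid.isMonoidBasis_iff_minimal.1 hB).eq_of_subset hleast.1 (hleast.2 hB.1) |>.symm
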